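/- Let $\Phi$ be a finite, reduced, irreducible crystallographic root system spanning the real vector space $\mathbb E$, which is endowed with a positive definite bilinear form $(\cdot,\cdot)$ invariant under the Weyl group. Let $\Pi$ be a set of simple roots of $\Phi$ and $\Phi^+$ the corresponding set of positive roots; write each root as $\gamma=\sum_{\alpha\in\Pi}c_\alpha(\gamma)\alpha$ and put $\operatorname{supp}(\gamma)=\{\alpha\in\Pi : c_\alpha(\gamma)\neq 0\}$. For $S\subseteq\Pi$ and $\beta\in\Phi$ let $$\Phi_{S,\beta}=\{\gamma\in\Phi : c_\alpha(\gamma)=c_\alpha(\beta)\text{ for all }\alpha\in S\}.$$ A vector $v\in\mathbb E$ is $(\Pi\setminus S)$-dominant if $(v,\alpha)\ge 0$ for all $\alpha\in\Pi\setminus S$, and $W\langle\Pi\setminus S\rangle$ is the subgroup of the Weyl group generated by the reflections $s_\alpha$, $\alpha\in\Pi\setminus S$. A root is long if no root of $\Phi$ is longer than it, and short otherwise (so if all roots have the same length, they are all long). (Oshima's Lemma) Let $S\subseteq\Pi$ and $\beta\in\Phi^+$ with $\operatorname{supp}(\beta)\cap S\neq\emptyset$. Then: 1. If $\Phi_{S,\beta}$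 contains a long (respectively short) root, then it contains exactly one $(\Pi\setminus S)$-dominant long (respectively short) root. 2. The group $W\langle\Pi\setminus S\rangle$ acts on the set of long roots of $\Phi_{S,\beta}$ and on the set of short roots of $\Phi_{S,\beta}$, and it is transitive on each of these sets that is non-empty. Hence $\Phi_{S,\beta}$ is a union of at most two $W\langle\Pi\setminus S\rangle$-orbits. -/

import Mathlib

noncomputable section

namespace OshimaLemma

variable {ι E E' : Type*} [AddCommGroup E] [Module ℝ E] [AddCommGroup E'] [Module ℝ E']
  {P : RootPairing ι ℝ E E'}

/-- The coordinate `c_α(v)` of `v` with respect to the basis of simple roots: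
`v = ∑ α ∈ Π, c_α(v) • α`. Simple roots are indexed by `b.support`. -/
def coord [P.IsRootSystem] (b : P.Base) (α : b.support) (v : E) : ℝ :=
  b.toWeightBasis.repr v α

/-- The support of `v`: the set of simple roots `α` with `c_α(v) ≠ 0`. -/
def supp [P.IsRootSystem] (b : P.Base) (v : E) : Set b.support :=
  {α | coord b α v ≠ 0}

/-- The set `Φ_{S,β}` of all roots `γ` with `c_α(γ) = c_α(β)` for all `α ∈ S`. -/
def slice [P.IsRootSystem] (b : P.Base) (S : Set b.support) (β : E) : Set E :=
  {γ | γ ∈ Set.range P.root ∧ ∀ α ∈ S, coord b α γ = coord b α β}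

/-- The subgroup `W⟨T⟩` of `GL(E)` generated by the reflections `s_α` with `α ∈ T`, for a set `T`
of simple roots. -/
def parabolic (b : P.Base) (T : Set b.support) : Subgroup (E ≃ₗ[ℝ] E) :=
  Subgroup.closure ((fun α : b.support => P.reflection α) '' T)

/-- `v` is `T`-dominant: `(v, α) ≥ 0` for all `α ∈ T`. -/
def IsDominant (B : P.RootPositiveForm ℝ) (b : P.Base) (T : Set b.support) (v : E) : Prop :=
  ∀ α ∈ T, 0 ≤ B.form v (P.root α)

/-- A root is long if no root is longer than it; so if all roots have the same length, they are
all long. -/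
def IsLong (B : P.RootPositiveForm ℝ) (γ : E) : Prop :=
  γ ∈ Set.range P.root ∧ ∀ δ ∈ Set.range P.root, B.form δ δ ≤ B.form γ γ

/-- A root is short if some root is longer than it. -/
def IsShort (B : P.RootPositiveForm ℝ) (γ : E) : Prop :=
  γ ∈ Set.range P.root ∧ ∃ δ ∈ Set.range P.root, B.form γ γ < B.form δ δ

end OshimaLemma

end

/-!
Write `J = Sᶜ`. The point is that two `J`-dominant roots `γ`, `δ` of the same slice `Φ_{S,β}` always
make an acute angle (`form_pos_of_dominant`). They differ by an element of the span of `J`, so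
`γ = p + g` and `δ = p + d` with the same component `p` orthogonal to that span and with `g`, `d` in
it. Here `p ≠ 0` because some coefficient of `β` on `S` is nonzero. Moreover `g` and `d` are dominant,
and a dominant vector of the span of `J` has nonnegative coordinates since simple roots are pairwise
obtuse (`repr_nonneg_of_form_nonneg`); hence `(g, d) ≥ 0` and `(γ, δ) = (p, p) + (g, d) > 0`.

If in addition `γ` and `δ` have the same length and are distinct, then `γ - δ` is a root in the span
of `J`, and, say, a positive one. Since `δ` is dominant, `γ = δ + (γ - δ)` is longer than `δ`, a
contradiction (`eq_of_isDominant`). On the other hand every `W⟨J⟩`-orbit in the slice contains a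
dominant root, namely one of largest height (`exists_isDominant_mem_orbit`). So the roots of one
length in the slice form a single orbit. In an irreducible root system the short roots all have the
same length, which gives at most two orbits.

The form `B` is only assumed positive on roots. The acute angle is therefore established for the
canonical form of the root system, which is positive definite, and carried over to `B` through the
signs of the integers `⟨γ, δ^∨⟩`.
-/

open LinearMap (BilinForm)

namespace OshimaLemma

/-! ### Dominant vectors for an obtuse basis -/

section Obtuse

variable {κ V : Type*} [Finite κ] [AddCommGroup V] [Module ℝ V]

/-- Writing `x = z - y` with `z`, `y` the positive and negative parts of `x` in the obtuse basis `e`,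
one has `0 ≤ (x, y) = (z, y) - (y, y) ≤ -(y, y)`, so `y = 0`. -/
lemma repr_nonneg_of_form_nonneg (Q : BilinForm ℝ V) (hpos : ∀ x, x ≠ 0 → 0 < Q x x)
    (e : Module.Basis κ ℝ V) (hobt : ∀ i j, i ≠ j → Q (e i) (e j) ≤ 0) (J : Set κ) {x : V}
    (hx : ∀ i ∉ J, e.repr x i = 0) (hdom : ∀ i ∈ J, 0 ≤ Q x (e i)) (i : κ) :
    0 ≤ e.repr x i := by
  have := Fintype.ofFinite κ
  set c : κ → ℝ := fun i => e.repr x i with hc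
  set y : V := ∑ i, (c i)⁻ • e i with hy
  set z : V := ∑ i, (c i)⁺ • e i with hz
  have hxzy : x = z - y := by
    rw [hz, hy, ← Finset.sum_sub_distrib]
    conv_lhs => rw [← e.sum_repr x]
    refine Finset.sum_congr rfl fun i _ => ?_
    rw [← sub_smul, posPart_sub_negPart]
  have hxy : 0 ≤ Q x y := by
    rw [hy, map_sum]
    refine Finset.sum_nonneg fun i _ => ?_
    rw [map_smul, smul_eq_mul]
    by_cases hi : i ∈ J
    · exact mul_nonneg (negPart_nonneg _) (hdom i hi)
    · simp [hc, hx i hi]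
  have hzy : Q z y ≤ 0 := by
    rw [hz, hy, LinearMap.BilinForm.sum_left]
    refine Finset.sum_nonpos fun i _ => ?_
    rw [map_sum]
    refine Finset.sum_nonpos fun j _ => ?_
    rw [map_smul, map_smul, LinearMap.smul_apply, smul_eq_mul, smul_eq_mul]
    rcases eq_or_ne i j with rfl | hij
    · rcases le_total 0 (c i) with h | h
      · simp [negPart_eq_zero.mpr h]
      · simp [posPart_eq_zero.mpr h]
    · exact mul_nonpos_of_nonneg_of_nonpos (negPart_nonneg _)
        (mul_nonpos_of_nonneg_of_nonpos (posPart_nonneg _) (hobt i j hij))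
  have hy0 : y = 0 := by
    by_contra h
    have h1 := hpos y h
    rw [hxzy, map_sub, LinearMap.sub_apply] at hxy
    linarith
  have := Fintype.linearIndependent_iff.mp e.linearIndependent _ hy0 i
  exact negPart_eq_zero.mp this

/-- Two `J`-dominant vectors that agree outside `J` and do not lie in the span of `J` make an acute
angle: they have the same nonzero component orthogonal to the span of `J`, and their components in
that span have nonnegative product. -/
lemma form_pos_of_dominant (Q : BilinForm ℝ V) (hsymm : LinearMap.IsSymm Q)
    (hpos : ∀ x, x ≠ 0 → 0 < Q x x) (e : Module.Basis κ ℝ V)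
    (hobt : ∀ i j, i ≠ j → Q (e i) (e j) ≤ 0) (J : Set κ) {x y : V}
    (hxy : ∀ i ∉ J, e.repr x i = e.repr y i) (hne : ∃ i ∉ J, e.repr x i ≠ 0)
    (hx : ∀ i ∈ J, 0 ≤ Q x (e i)) (hy : ∀ i ∈ J, 0 ≤ Q y (e i)) :
    0 < Q x y := by
  have := Fintype.ofFinite κ
  have := Module.Finite.of_basis e
  set W := Submodule.span ℝ (e '' J) with hW
  have hmem (v : V) : v ∈ W ↔ ∀ i ∉ J, e.repr v i = 0 := by
    rw [hW, Module.Basis.mem_span_image]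
    simp only [Set.subset_def, Finset.mem_coe, Finsupp.mem_support_iff]
    exact forall_congr' fun i => not_imp_comm
  have hcompl : IsCompl W (Q.orthogonal W) := by
    refine (LinearMap.BilinForm.isCompl_orthogonal_iff_disjoint hsymm.isRefl).mpr ?_
    refine Submodule.disjoint_def.mpr fun v hv hv' => ?_
    by_contra h
    exact (hpos v h).ne' (hv' v hv)
  obtain ⟨g, hg, p, hp, hgp⟩ := Submodule.mem_sup.mp (hcompl.sup_eq_top ▸ Submodule.mem_top (x := x))
  have hd : y - p ∈ W := by
    have h : y - x ∈ W := (hmem _).mpr fun i hi => by simp [hxy i hi]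
    have : y - p = (y - x) + g := by rw [← hgp]; abel
    exact this ▸ W.add_mem h hg
  have hp0 : p ≠ 0 := by
    rintro rfl
    obtain ⟨i, hi, h⟩ := hne
    refine h ((hmem x).mp ?_ i hi)
    simpa [← hgp] using hg
  have hpw (w : V) (hw : w ∈ W) : Q p w = 0 := by
    rw [← hsymm.eq, RingHom.id_apply]; exact hp w hw
  have hgn := repr_nonneg_of_form_nonneg Q hpos e hobt J ((hmem g).mp hg) fun i hi => by
    have h := hx i hi
    rwa [← hgp, map_add, LinearMap.add_apply,
      hpw _ (Submodule.subset_span (Set.mem_image_of_mem e hi)), add_zero] at h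
  have hyg : 0 ≤ Q y g := by
    rw [← e.sum_repr g, map_sum]
    refine Finset.sum_nonneg fun i _ => ?_
    rw [map_smul, smul_eq_mul]
    by_cases hi : i ∈ J
    · exact mul_nonneg (hgn i) (hy i hi)
    · simp [(hmem g).mp hg i hi]
  have h1 : Q p y = Q p p := by
    have := hpw _ hd
    rw [map_sub] at this
    linarith
  have h2 : Q g y = Q y g := by rw [← hsymm.eq, RingHom.id_apply]
  rw [← hgp, map_add, LinearMap.add_apply, h1, h2]
  linarith [hpos p hp0]

end Obtuse

/-! ### Dominant roots of a slice -/

section Roots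

variable {ι E E' : Type*} [AddCommGroup E] [Module ℝ E] [AddCommGroup E'] [Module ℝ E']
  {P : RootPairing ι ℝ E E'}

lemma form_root_self_pos (B : P.RootPositiveForm ℝ) (i : ι) :
    0 < B.form (P.root i) (P.root i) := by
  obtain ⟨s, hs, h⟩ := B.exists_pos_eq i
  simpa [← h] using hs

lemma form_root_root_pos_iff (B : P.RootPositiveForm ℝ) (i j : ι) :
    0 < B.form (P.root i) (P.root j) ↔ 0 < P.pairing i j := by
  have h := B.two_mul_apply_root_root i j
  have hj := form_root_self_pos B j
  refine Iff.trans ?_ (mul_pos_iff_of_pos_right hj)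
  simp [← h]

lemma form_root_root_nonneg_iff (B : P.RootPositiveForm ℝ) (i j : ι) :
    0 ≤ B.form (P.root i) (P.root j) ↔ 0 ≤ P.pairing i j := by
  have h := B.two_mul_apply_root_root i j
  have hj := form_root_self_pos B j
  refine Iff.trans ?_ (mul_nonneg_iff_of_pos_right hj)
  simp [← h]

lemma IsLong.form_self_eq {B : P.RootPositiveForm ℝ} {γ δ : E} (hγ : IsLong B γ)
    (hδ : IsLong B δ) : B.form γ γ = B.form δ δ :=
  le_antisymm (hδ.2 γ hγ.1) (hγ.2 δ hδ.1)

lemma isLong_or_isShort (B : P.RootPositiveForm ℝ) (i : ι) :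
    IsLong B (P.root i) ∨ IsShort B (P.root i) := by
  by_cases h : ∀ δ ∈ Set.range P.root, B.form δ δ ≤ B.form (P.root i) (P.root i)
  · exact .inl ⟨⟨i, rfl⟩, h⟩
  · push Not at h
    exact .inr ⟨⟨i, rfl⟩, h⟩

variable [Finite ι]

/-- By irreducibility there are at most two root lengths, so all short roots have the same one. -/
lemma IsShort.form_self_eq [P.IsCrystallographic] [P.IsReduced] [P.IsIrreducible]
    {B : P.RootPositiveForm ℝ} {γ δ : E} (hγ : IsShort B γ) (hδ : IsShort B δ) :
    B.form γ γ = B.form δ δ := by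
  obtain ⟨⟨i, rfl⟩, -, ⟨k, rfl⟩, hk⟩ := hγ
  obtain ⟨⟨j, rfl⟩, -, ⟨l, rfl⟩, hl⟩ := hδ
  have hj := B.toInvariantForm.apply_eq_or_of_apply_ne (i := i) (j := k) hk.ne j
  have h' := B.toInvariantForm.apply_eq_or_of_apply_ne (i := i) (j := k) hk.ne l
  simp only [RootPairing.RootPositiveForm.toInvariantForm_form] at hj h'
  grind

/-- Two roots that agree outside `J`, do not lie in the span of `J` and are both `J`-dominant make
an acute angle. This is `form_pos_of_dominant` for the canonical form `P.posRootForm ℝ`, which is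
visibly positive definite, being a sum of squares of coroots; its sign on pairs of roots is that of
the pairing, as for every invariant form that is positive on roots. -/
lemma pairing_pos_of_dominant [P.IsRootSystem] [P.IsCrystallographic] (b : P.Base)
    (J : Set b.support) {i j : ι}
    (hij : ∀ α ∉ J, coord b α (P.root i) = coord b α (P.root j))
    (hne : ∃ α ∉ J, coord b α (P.root i) ≠ 0)
    (hi : ∀ α ∈ J, 0 ≤ P.pairing i α) (hj : ∀ α ∈ J, 0 ≤ P.pairing j α) :
    0 < P.pairing i j := by
  have := Fintype.ofFinite ι
  let Q := P.posRootForm ℝ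
  have hpos (x : E) (hx : x ≠ 0) : 0 < Q.form x x := by
    have : Q.form x x = ∑ k, P.coroot' k x * P.coroot' k x := P.rootForm_apply_apply x x
    rw [this]
    contrapose! hx
    refine P.eq_zero_iff_forall_coroot'_eq_zero.mpr fun k => ?_
    have h0 := (Finset.sum_eq_zero_iff_of_nonneg fun k _ => mul_self_nonneg (P.coroot' k x)).mp
      (le_antisymm hx (Finset.sum_nonneg fun k _ => mul_self_nonneg _)) k (Finset.mem_univ k)
    exact mul_self_eq_zero.mp h0
  rw [← form_root_root_pos_iff Q]
  refine form_pos_of_dominant Q.form Q.symm hpos b.toWeightBasis (fun α α' h => ?_) J hij hne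
    (fun α hα => ?_) fun α hα => ?_
  · rw [b.toWeightBasis_apply, b.toWeightBasis_apply, ← not_lt, form_root_root_pos_iff, not_lt,
      ← P.algebraMap_pairingIn ℤ, algebraMap_int_eq, eq_intCast]
    have := b.pairingIn_le_zero_of_ne (Subtype.coe_injective.ne h) α.2 α'.2
    exact_mod_cast this
  · rw [b.toWeightBasis_apply, form_root_root_nonneg_iff]; exact hi α hα
  · rw [b.toWeightBasis_apply, form_root_root_nonneg_iff]; exact hj α hα

omit [Finite ι] in
lemma coord_nonneg_or_nonpos [P.IsRootSystem] (b : P.Base) (i : ι) :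
    (∀ α, 0 ≤ coord b α (P.root i)) ∨ ∀ α, coord b α (P.root i) ≤ 0 := by
  have key (v : E) (hv : v ∈ AddSubmonoid.closure (P.root '' b.support)) (α : b.support) :
      0 ≤ coord b α v := by
    induction hv using AddSubmonoid.closure_induction with
    | mem x hx =>
      obtain ⟨j, hj, rfl⟩ := hx
      have := b.toWeightBasis_repr_root ⟨j, hj⟩
      rw [coord, this]
      classical
      rw [Finsupp.single_apply]
      split_ifs <;> norm_num
    | zero => simp [coord]
    | add x y _ _ hx hy => simpa [coord] using add_nonneg hx hy
  refine (b.root_mem_or_neg_mem i).imp (key _) fun h α => ?_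
  simpa [coord] using key _ h α

/-- Dominant roots of equal length in a slice coincide: their difference would be a root in the
span of `Sᶜ`, and adding a positive such root to a dominant root makes it strictly longer. -/
lemma eq_of_isDominant [P.IsRootSystem] [P.IsCrystallographic] (B : P.RootPositiveForm ℝ)
    (b : P.Base) (S : Set b.support) {β : E} (hS : (supp b β ∩ S).Nonempty) {γ δ : E}
    (hγ : γ ∈ slice b S β) (hδ : δ ∈ slice b S β) (hlen : B.form γ γ = B.form δ δ)
    (hγd : IsDominant B b Sᶜ γ) (hδd : IsDominant B b Sᶜ δ) : γ = δ := by
  obtain ⟨⟨i, rfl⟩, hi⟩ := hγ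
  obtain ⟨⟨j, rfl⟩, hj⟩ := hδ
  by_contra hne
  have hpos : 0 < P.pairing i j := by
    refine pairing_pos_of_dominant b Sᶜ (fun α hα => ?_) ?_
      (fun α hα => (form_root_root_nonneg_iff B i α).mp (hγd α hα))
      (fun α hα => (form_root_root_nonneg_iff B j α).mp (hδd α hα))
    · rw [Set.notMem_compl_iff] at hα
      rw [hi α hα, hj α hα]
    · obtain ⟨α, hα, hαS⟩ := hS
      exact ⟨α, by simpa using hαS, by rw [hi α hαS]; exact hα⟩
  have hposZ : 0 < P.pairingIn ℤ i j := by
    rw [← P.algebraMap_pairingIn ℤ, algebraMap_int_eq, eq_intCast] at hpos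
    exact_mod_cast hpos
  obtain ⟨k, hk⟩ := P.root_sub_root_mem_of_pairingIn_pos hposZ fun h => hne (h ▸ rfl)
  have hkS (α : b.support) (hα : α ∈ S) : coord b α (P.root k) = 0 := by
    have := (hi α hα).trans (hj α hα).symm
    simpa [hk, coord, sub_eq_zero] using this
  have hsum (v : E) : B.form v (P.root k) =
      ∑ α : b.support, coord b α (P.root k) * B.form v (P.root α) := by
    conv_lhs => rw [← b.toWeightBasis.sum_repr (P.root k), map_sum]
    simp [coord]
  have hkpos := form_root_self_pos B k
  have hkk : B.form (P.root k) (P.root k) =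
      B.form (P.root i) (P.root k) - B.form (P.root j) (P.root k) := by
    conv_lhs => rw [hk]
    simp [hk]
  -- `(γ + δ, γ - δ) = (γ, γ) - (δ, δ) = 0`
  have hexp : B.form (P.root i) (P.root k) + B.form (P.root j) (P.root k) = 0 := by
    have : B.form (P.root j) (P.root i) = B.form (P.root i) (P.root j) := by
      rw [← B.symm.eq]; rfl
    simp only [hk, map_sub, this, hlen]
    ring
  rcases coord_nonneg_or_nonpos b k with h | h
  · have : 0 ≤ B.form (P.root j) (P.root k) := by
      rw [hsum]
      refine Finset.sum_nonneg fun α _ => ?_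
      by_cases hα : α ∈ S
      · simp [hkS α hα]
      · exact mul_nonneg (h α) (hδd α hα)
    linarith
  · have : B.form (P.root i) (P.root k) ≤ 0 := by
      rw [hsum]
      refine Finset.sum_nonpos fun α _ => ?_
      by_cases hα : α ∈ S
      · simp [hkS α hα]
      · exact mul_nonpos_of_nonpos_of_nonneg (h α) (hγd α hα)
    linarith

omit [Finite ι] in
lemma reflection_mem_slice [P.IsRootSystem] (b : P.Base) (S : Set b.support) {β γ : E}
    (hγ : γ ∈ slice b S β) {α : b.support} (hα : α ∉ S) :
    P.reflection α γ ∈ slice b S β := by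
  obtain ⟨⟨i, rfl⟩, hi⟩ := hγ
  refine ⟨⟨P.reflectionPerm α i, P.root_reflectionPerm α i⟩, fun α' hα' => ?_⟩
  have : α ≠ α' := fun h => hα (h ▸ hα')
  rw [← hi α' hα', P.reflection_apply]
  simp [coord, this]

end Roots

/-! ### Orbits of the parabolic subgroup -/

section Orbits

variable {ι E E' : Type*} [AddCommGroup E] [Module ℝ E] [AddCommGroup E'] [Module ℝ E']
  {P : RootPairing ι ℝ E E'}

lemma parabolic_apply_mem_slice_iff [P.IsRootSystem] (b : P.Base) (S : Set b.support) {β : E}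
    {g : E ≃ₗ[ℝ] E} (hg : g ∈ parabolic b Sᶜ) (γ : E) :
    g γ ∈ slice b S β ↔ γ ∈ slice b S β := by
  induction hg using Subgroup.closure_induction generalizing γ with
  | mem x hx =>
    obtain ⟨α, hα, rfl⟩ := hx
    refine ⟨fun h => ?_, fun h => reflection_mem_slice b S h hα⟩
    simpa using reflection_mem_slice b S h hα
  | one => rfl
  | mul x y _ _ hx hy => rw [LinearEquiv.mul_apply, hx, hy]
  | inv x _ hx => rw [← hx (x⁻¹ γ), ← LinearEquiv.mul_apply, mul_inv_cancel, LinearEquiv.coe_one,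
      id_eq]

lemma form_parabolic_apply (B : P.RootPositiveForm ℝ) (b : P.Base) (T : Set b.support)
    {g : E ≃ₗ[ℝ] E} (hg : g ∈ parabolic b T) (v w : E) :
    B.form (g v) (g w) = B.form v w := by
  induction hg using Subgroup.closure_induction generalizing v w with
  | mem x hx =>
    obtain ⟨α, -, rfl⟩ := hx
    exact B.isOrthogonal_reflection α v w
  | one => rfl
  | mul x y _ _ hx hy => rw [LinearEquiv.mul_apply, LinearEquiv.mul_apply, hx, hy]
  | inv x _ hx => rw [← hx (x⁻¹ v), ← LinearEquiv.mul_apply, ← LinearEquiv.mul_apply,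
      mul_inv_cancel, LinearEquiv.coe_one, id_eq, id_eq]

variable [Finite ι]

/-- A root of largest height in its orbit is dominant, because reflecting a root in a simple root
with which its product is negative increases the height. -/
lemma exists_isDominant_mem_orbit [P.IsRootSystem] (B : P.RootPositiveForm ℝ) (b : P.Base)
    (S : Set b.support) {β γ : E} (hγ : γ ∈ slice b S β) :
    ∃ δ ∈ MulAction.orbit (parabolic b Sᶜ) γ, δ ∈ slice b S β ∧ IsDominant B b Sᶜ δ := by
  have hslice (δ : E) (hδ : δ ∈ MulAction.orbit (parabolic b Sᶜ) γ) : δ ∈ slice b S β := by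
    obtain ⟨⟨g, hg⟩, rfl⟩ := hδ
    exact (parabolic_apply_mem_slice_iff b S hg γ).mpr hγ
  have hfin : (MulAction.orbit (parabolic b Sᶜ) γ).Finite :=
    (Set.finite_range P.root).subset fun δ hδ => (hslice δ hδ).1
  obtain ⟨δ, hδ, hmax⟩ := Set.exists_max_image _ (fun v => ∑ α : b.support, coord b α v) hfin
    ⟨γ, MulAction.mem_orbit_self γ⟩
  refine ⟨δ, hδ, hslice δ hδ, fun α hα => ?_⟩
  obtain ⟨⟨i, rfl⟩, -⟩ := hslice δ hδ
  have hr : P.reflection α (P.root i) ∈ MulAction.orbit (parabolic b Sᶜ) γ := by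
    rw [← MulAction.orbit_eq_iff.mpr hδ]
    exact ⟨⟨P.reflection α, Subgroup.subset_closure ⟨α, hα, rfl⟩⟩, rfl⟩
  rw [form_root_root_nonneg_iff]
  -- Reflecting in `α` changes the height by `-⟨δ, α^∨⟩`, which maximality forces to be nonpositive.
  have := hmax _ hr
  have hα1 : ∑ α' : b.support, b.toWeightBasis.repr (P.root α) α' = 1 := by
    classical
    simp [Finsupp.single_apply]
  simp only [coord, P.reflection_apply_root, map_sub, map_smul, Finsupp.coe_sub, Finsupp.coe_smul,
    Pi.sub_apply, Pi.smul_apply, Finset.sum_sub_distrib, smul_eq_mul, ← Finset.mul_sum, hα1] at this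
  linarith

variable [P.IsRootSystem] [P.IsCrystallographic] (B : P.RootPositiveForm ℝ) (b : P.Base)
  (S : Set b.support) {β : E} (hS : (supp b β ∩ S).Nonempty) {K : E → Prop}
  (hK : ∀ γ δ, γ ∈ Set.range P.root → δ ∈ Set.range P.root → K γ →
    (K δ ↔ B.form γ γ = B.form δ δ))
include hS hK

/-- The predicate `K` stands for `IsLong B` or `IsShort B`; by `hK`, it cuts out the roots of one
length. -/
lemma existsUnique_isDominant_of_length (h : ∃ γ ∈ slice b S β, K γ) :
    ∃! γ, γ ∈ slice b S β ∧ K γ ∧ IsDominant B b Sᶜ γ := by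
  obtain ⟨γ, hγ, hγK⟩ := h
  obtain ⟨δ, ⟨⟨g, hg⟩, rfl⟩, hδ, hd⟩ := exists_isDominant_mem_orbit B b S hγ
  have hδK := (hK γ _ hγ.1 hδ.1 hγK).mpr (form_parabolic_apply B b Sᶜ hg γ γ).symm
  refine ⟨_, ⟨hδ, hδK, hd⟩, fun η ⟨hη, hηK, hηd⟩ => ?_⟩
  exact eq_of_isDominant B b S hS hη hδ ((hK η _ hη.1 hδ.1 hηK).mp hδK) hηd hd

/-- The roots of one length in a slice, cut out by `K`, form a single orbit: two orbits share their
unique dominant root. -/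
lemma orbit_eq_of_length {γ : E} (hγ : γ ∈ slice b S β) (hγK : K γ) :
    MulAction.orbit (parabolic b Sᶜ) γ = {δ | δ ∈ slice b S β ∧ K δ} := by
  have hsub (η : E) (hη : η ∈ slice b S β) (hηK : K η) (δ : E)
      (hδ : δ ∈ MulAction.orbit (parabolic b Sᶜ) η) : δ ∈ slice b S β ∧ K δ := by
    obtain ⟨⟨g, hg⟩, rfl⟩ := hδ
    have hgη := (parabolic_apply_mem_slice_iff b S hg η).mpr hη
    exact ⟨hgη, (hK η _ hη.1 hgη.1 hηK).mpr (form_parabolic_apply B b Sᶜ hg η η).symm⟩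
  refine Set.Subset.antisymm (hsub γ hγ hγK) fun δ ⟨hδ, hδK⟩ => ?_
  obtain ⟨γ', hγ', hγs, hγd⟩ := exists_isDominant_mem_orbit B b S hγ
  obtain ⟨δ', hδ', hδs, hδd⟩ := exists_isDominant_mem_orbit B b S hδ
  have : γ' = δ' := (existsUnique_isDominant_of_length B b S hS hK ⟨γ, hγ, hγK⟩).unique
    ⟨hγs, (hsub γ hγ hγK γ' hγ').2, hγd⟩ ⟨hδs, (hsub δ hδ hδK δ' hδ').2, hδd⟩
  subst this
  rw [← MulAction.orbit_eq_iff.mpr hγ', MulAction.orbit_eq_iff.mpr hδ']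
  exact MulAction.mem_orbit_self δ

end Orbits
end OshimaLemma

theorem mainTheorem1 {ι E E' : Type*} [Finite ι]
    [AddCommGroup E] [Module ℝ E] [AddCommGroup E'] [Module ℝ E']
    (P : RootPairing ι ℝ E E') [P.IsRootSystem] [P.IsCrystallographic] [P.IsReduced]
    [P.IsIrreducible] (B : P.RootPositiveForm ℝ) (b : P.Base)
    (S : Set b.support) (β : ι) (hβ : b.IsPos β)
    (hS : (OshimaLemma.supp b (P.root β) ∩ S).Nonempty) :
    -- if there is a long root, there is exactly one dominant long root; same for short roots
    ((∃ γ ∈ OshimaLemma.slice b S (P.root β), OshimaLemma.IsLong B γ) →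
      ∃! γ, γ ∈ OshimaLemma.slice b S (P.root β) ∧ OshimaLemma.IsLong B γ ∧
        OshimaLemma.IsDominant B b Sᶜ γ) ∧
    ((∃ γ ∈ OshimaLemma.slice b S (P.root β), OshimaLemma.IsShort B γ) →
      ∃! γ, γ ∈ OshimaLemma.slice b S (P.root β) ∧ OshimaLemma.IsShort B γ ∧
        OshimaLemma.IsDominant B b Sᶜ γ) ∧
    -- the orbit of each long root is the set of all long roots; same for short roots
    (∀ γ ∈ OshimaLemma.slice b S (P.root β), OshimaLemma.IsLong B γ →
      MulAction.orbit (OshimaLemma.parabolic b Sᶜ) γ =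
        {δ | δ ∈ OshimaLemma.slice b S (P.root β) ∧ OshimaLemma.IsLong B δ}) ∧
    (∀ γ ∈ OshimaLemma.slice b S (P.root β), OshimaLemma.IsShort B γ →
      MulAction.orbit (OshimaLemma.parabolic b Sᶜ) γ =
        {δ | δ ∈ OshimaLemma.slice b S (P.root β) ∧ OshimaLemma.IsShort B δ}) ∧
    -- there are at most two orbits
    ((fun γ : E => MulAction.orbit (OshimaLemma.parabolic b Sᶜ) γ) ''
      OshimaLemma.slice b S (P.root β)).encard ≤ 2 := by

  have hlong (γ δ : E) (_ : γ ∈ Set.range P.root) (hδ : δ ∈ Set.range P.root)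
      (h : OshimaLemma.IsLong B γ) : OshimaLemma.IsLong B δ ↔ B.form γ γ = B.form δ δ :=
    ⟨fun h' => h.form_self_eq h', fun h' => ⟨hδ, fun η hη => h' ▸ h.2 η hη⟩⟩
  have hshort (γ δ : E) (_ : γ ∈ Set.range P.root) (hδ : δ ∈ Set.range P.root)
      (h : OshimaLemma.IsShort B γ) : OshimaLemma.IsShort B δ ↔ B.form γ γ = B.form δ δ :=
    ⟨fun h' => h.form_self_eq h', fun h' => ⟨hδ, h' ▸ h.2⟩⟩
  have hlong_orbit := fun γ hγ =>
    OshimaLemma.orbit_eq_of_length B b S hS (K := OshimaLemma.IsLong B) hlong (γ := γ) hγ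
  have hshort_orbit := fun γ hγ =>
    OshimaLemma.orbit_eq_of_length B b S hS (K := OshimaLemma.IsShort B) hshort (γ := γ) hγ
  refine ⟨OshimaLemma.existsUnique_isDominant_of_length B b S hS hlong,
    OshimaLemma.existsUnique_isDominant_of_length B b S hS hshort, hlong_orbit, hshort_orbit, ?_⟩
  refine (Set.encard_le_encard (t := {
    {δ | δ ∈ OshimaLemma.slice b S (P.root β) ∧ OshimaLemma.IsLong B δ},
    {δ | δ ∈ OshimaLemma.slice b S (P.root β) ∧ OshimaLemma.IsShort B δ}}) ?_).trans
    (Set.encard_insert_le _ _ |>.trans (by rw [Set.encard_singleton]; norm_num))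
  rintro _ ⟨γ, hγ, rfl⟩
  obtain ⟨i, rfl⟩ := hγ.1
  rcases OshimaLemma.isLong_or_isShort B i with h | h
  · exact .inl (hlong_orbit _ hγ h)
  · exact .inr (hshort_orbit _ hγ h)
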